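/- Let $G$ be a second countable locally compact Hausdorff group with right Haar measure $\lambda$, and let $a\in G$ be aperiodic, i.e. the closed subgroup generated by $a$ is not compact. Let $\Phi:\mathbb R\to\mathbb R$ be a Young function: continuous, even and convex, with $\Phi(0)=0$, $\Phi(t)>0$ for $t>0$ and $\lim_{t\to\infty}\Phi(t)=\infty$. Assume that $\Phi$ is $\Delta_2$-regular: there are $M,t_0>0$ with $\Phi(2t)\le M\Phi(t)$ for all $t\ge t_0$ if $G$ is compact, and there is $M>0$ with $\Phi(2t)\le M\Phi(t)$ for all $t>0$ if $G$ is noncompact. Let $L^\Phi(G)$ be the Orlicz space of (classes modulo $\lambda$-a.e. equality of) Borel functions $f:G\to\mathbb C$ such that $\int_G\Phi(\alpha|f|)\,d\lambda<\infty$ for some $\alpha>0$, with the Luxemburg norm $N_\Phi(f)=\inf\{k>0:\int_G\Phi(|f|/k)\,d\lambda\le 1\}$. Let $w:G\to(0,\infty)$ be continuous with $w$ and $w^{-1}$ bounded, and let $T_{a,w}$ be the bounded operator on $L^\Phi(G)$ given by $T_{a,w}f(x)=w(x)f(xa^{-1})$. For $n\ge1$ put $$\varphi_n(x)=\prod_{j=1}^{n}w(xa^{j}),\qquad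 \widetilde\varphi_n(x)=\Big(\prod_{j=0}^{n-1}w(xa^{-j})\Big)^{-1}.$$ Then the following are equivalent. (i) $T_{a,w}$ is topologically multiply recurrent on $L^\Phi(G)$: for every integer $L\ge1$ and every nonempty open $U\subset L^\Phi(G)$ there is an integer $n\ge1$ with $U\cap T_{a,w}^{-n}U\cap T_{a,w}^{-2n}U\cap\dots\cap T_{a,w}^{-Ln}U\ne\emptyset$. (ii) For every integer $L\ge1$ and every compact $K\subset G$ with $\lambda(K)>0$ there are Borel sets $E_k\subset K$ with $\lim_{k\to\infty}\lambda(E_k)=\lambda(K)$ and a strictly increasing sequence of positive integers $(n_k)$ such that, for all $1\le l\le L$, $$\lim_{k\to\infty}\big\|\varphi_{ln_k}|_{E_k}\big\|_\infty=\lim_{k\to\infty}\big\|\widetilde\varphi_{ln_k}|_{E_k}\big\|_\infty=0,$$ where $\|\cdot\|_\infty$ is the essential supremum norm with respect to $\lambda$. -/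

import Mathlib

open MeasureTheory Filter Topology
open scoped ENNReal

noncomputable section

/-! ### Young functions -/

/-- A Young function: a continuous, even, convex function `Φ : ℝ → ℝ` with `Φ 0 = 0`,
`Φ t > 0` for `t > 0` and `Φ t → ∞` as `t → ∞`. -/
structure YoungFunction where
  toFun : ℝ → ℝ
  continuous' : Continuous toFun
  even' : ∀ t, toFun (-t) = toFun t
  convex' : ConvexOn ℝ Set.univ toFun
  map_zero' : toFun 0 = 0
  pos' : ∀ t, 0 < t → 0 < toFun t
  tendsto' : Tendsto toFun atTop atTop

namespace YoungFunction

instance : CoeFun YoungFunction (fun _ => ℝ → ℝ) := ⟨toFun⟩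

/-- `Δ₂`-regularity of a Young function relative to the group (space) `G`: the doubling
condition for large arguments if `G` is compact, for all positive arguments otherwise. -/
def IsDelta2Regular (Φ : YoungFunction) (G : Type*) [TopologicalSpace G] : Prop :=
  (CompactSpace G → ∃ M > 0, ∃ t₀ > 0, ∀ t ≥ t₀, Φ (2 * t) ≤ M * Φ t) ∧
  (¬ CompactSpace G → ∃ M > 0, ∀ t > 0, Φ (2 * t) ≤ M * Φ t)

theorem nonneg (Φ : YoungFunction) {t : ℝ} (ht : 0 ≤ t) : 0 ≤ Φ t := by
  rcases ht.eq_or_lt with h | h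
  · rw [← h, Φ.map_zero']
  · exact (Φ.pos' t h).le

theorem mul_le (Φ : YoungFunction) {s t : ℝ} (hs : 0 ≤ s) (hs1 : s ≤ 1) :
    Φ (s * t) ≤ s * Φ t := by
  have h := Φ.convex'.2 (Set.mem_univ t) (Set.mem_univ 0) hs (sub_nonneg.2 hs1) (by ring)
  simpa [Φ.map_zero'] using h

theorem mono (Φ : YoungFunction) {s t : ℝ} (hs : 0 ≤ s) (hst : s ≤ t) : Φ s ≤ Φ t := by
  rcases (hs.trans hst).eq_or_lt with h | h
  · have : s = t := by linarith
    rw [this]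
  · have h1 := Φ.mul_le (t := t) (div_nonneg hs h.le) ((div_le_one h).2 hst)
    rw [div_mul_cancel₀ _ h.ne'] at h1
    exact h1.trans (mul_le_of_le_one_left (Φ.nonneg h.le) ((div_le_one h).2 hst))

variable {α : Type*} [MeasurableSpace α]

/-- The modular `∫ Φ(g) dμ ∈ [0, ∞]` of a real function `g`. -/
def modular (Φ : YoungFunction) (μ : Measure α) (g : α → ℝ) : ℝ≥0∞ :=
  ∫⁻ x, ENNReal.ofReal (Φ (g x)) ∂μ

/-- The integrability condition defining the Orlicz space: `∫ Φ(c |f|) dμ < ∞` for some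
`c > 0`. -/
def MemOrlicz (Φ : YoungFunction) (μ : Measure α) (f : α → ℂ) : Prop :=
  ∃ c : ℝ, 0 < c ∧ Φ.modular μ (fun x => c * ‖f x‖) < ∞

/-- The Luxemburg norm `N_Φ(f) = inf {k > 0 : ∫ Φ(|f| / k) dμ ≤ 1}`. -/
def luxemburgNorm (Φ : YoungFunction) (μ : Measure α) (f : α → ℂ) : ℝ :=
  sInf {k : ℝ | 0 < k ∧ Φ.modular μ (fun x => ‖f x‖ / k) ≤ 1}

variable {Φ : YoungFunction} {μ : Measure α} {f g : α → ℂ}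

theorem modular_mono_ae {u v : α → ℝ} (hu : ∀ x, 0 ≤ u x) (h : ∀ᵐ x ∂μ, u x ≤ v x) :
    Φ.modular μ u ≤ Φ.modular μ v :=
  lintegral_mono_ae (h.mono fun x hx => ENNReal.ofReal_le_ofReal (Φ.mono (hu x) hx))

theorem memOrlicz_iff :
    Φ.MemOrlicz μ f ↔ ∃ k : ℝ, 0 < k ∧ Φ.modular μ (fun x => ‖f x‖ / k) ≤ 1 := by
  constructor
  · rintro ⟨c, hc, hlt⟩
    set C := (Φ.modular μ (fun x => c * ‖f x‖)).toReal with hC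
    have hC0 : 0 ≤ C := ENNReal.toReal_nonneg
    have hs : 0 < (C + 1)⁻¹ := by positivity
    refine ⟨(C + 1) / c, by positivity, ?_⟩
    calc Φ.modular μ (fun x => ‖f x‖ / ((C + 1) / c))
        ≤ ∫⁻ x, ENNReal.ofReal ((C + 1)⁻¹) * ENNReal.ofReal (Φ (c * ‖f x‖)) ∂μ := by
          refine lintegral_mono fun x => ?_
          rw [← ENNReal.ofReal_mul hs.le]
          refine ENNReal.ofReal_le_ofReal ?_
          have := Φ.mul_le (t := c * ‖f x‖) hs.le (inv_le_one_of_one_le₀ (by linarith))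
          convert this using 2
          field_simp
      _ = ENNReal.ofReal ((C + 1)⁻¹) * Φ.modular μ (fun x => c * ‖f x‖) :=
          lintegral_const_mul' _ _ ENNReal.ofReal_ne_top
      _ = ENNReal.ofReal ((C + 1)⁻¹ * C) := by
          rw [ENNReal.ofReal_mul hs.le, hC, ENNReal.ofReal_toReal hlt.ne]
      _ ≤ 1 := by
          rw [ENNReal.ofReal_le_one, inv_mul_le_iff₀ (by positivity)]
          linarith
  · rintro ⟨k, hk, h⟩
    refine ⟨k⁻¹, by positivity, ?_⟩
    simp only [inv_mul_eq_div]
    exact h.trans_lt ENNReal.one_lt_top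

theorem modular_div_mono {k k' : ℝ} (hk : 0 < k) (hkk : k ≤ k') :
    Φ.modular μ (fun x => ‖f x‖ / k') ≤ Φ.modular μ (fun x => ‖f x‖ / k) := by
  refine modular_mono_ae (fun x => div_nonneg (norm_nonneg _) (hk.le.trans hkk)) ?_
  exact Eventually.of_forall fun x => by gcongr

theorem luxemburgNorm_nonneg : 0 ≤ Φ.luxemburgNorm μ f :=
  Real.sInf_nonneg fun _ hk => hk.1.le

theorem luxemburgNorm_le {k : ℝ} (hk : 0 < k) (h : Φ.modular μ (fun x => ‖f x‖ / k) ≤ 1) :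
    Φ.luxemburgNorm μ f ≤ k :=
  csInf_le ⟨0, fun _ hk => hk.1.le⟩ ⟨hk, h⟩

theorem modular_le_one_of_lt {k : ℝ} (hf : Φ.MemOrlicz μ f) (hk : Φ.luxemburgNorm μ f < k) :
    Φ.modular μ (fun x => ‖f x‖ / k) ≤ 1 := by
  obtain ⟨k', ⟨hk', h⟩, hlt⟩ := exists_lt_of_csInf_lt (memOrlicz_iff.1 hf) hk
  exact (modular_div_mono hk' hlt.le).trans h

theorem modular_add_le {k l : ℝ} (hk : 0 < k) (hl : 0 < l) (hfm : AEStronglyMeasurable f μ)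
    (hf : Φ.modular μ (fun x => ‖f x‖ / k) ≤ 1) (hg : Φ.modular μ (fun x => ‖g x‖ / l) ≤ 1) :
    Φ.modular μ (fun x => ‖f x + g x‖ / (k + l)) ≤ 1 := by
  have hkl : 0 < k + l := by positivity
  have e1 : ENNReal.ofReal (k / (k + l)) + ENNReal.ofReal (l / (k + l)) = 1 := by
    rw [← ENNReal.ofReal_add (by positivity) (by positivity), ← add_div, div_self hkl.ne',
      ENNReal.ofReal_one]
  calc Φ.modular μ (fun x => ‖f x + g x‖ / (k + l))
      ≤ ∫⁻ x, (ENNReal.ofReal (k / (k + l)) * ENNReal.ofReal (Φ (‖f x‖ / k))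
          + ENNReal.ofReal (l / (k + l)) * ENNReal.ofReal (Φ (‖g x‖ / l))) ∂μ := by
        refine lintegral_mono fun x => ?_
        have hp : 0 ≤ Φ (‖f x‖ / k) := Φ.nonneg (by positivity)
        have hq : 0 ≤ Φ (‖g x‖ / l) := Φ.nonneg (by positivity)
        rw [← ENNReal.ofReal_mul (by positivity), ← ENNReal.ofReal_mul (by positivity),
          ← ENNReal.ofReal_add (by positivity) (by positivity)]
        refine ENNReal.ofReal_le_ofReal ?_
        have h1 := Φ.convex'.2 (Set.mem_univ (‖f x‖ / k)) (Set.mem_univ (‖g x‖ / l))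
          (show 0 ≤ k / (k + l) by positivity) (show 0 ≤ l / (k + l) by positivity)
          (by rw [← add_div, div_self hkl.ne'])
        refine le_trans (Φ.mono (by positivity) ?_) h1
        calc ‖f x + g x‖ / (k + l) ≤ (‖f x‖ + ‖g x‖) / (k + l) := by
              gcongr; exact norm_add_le _ _
          _ = _ := by simp only [smul_eq_mul]; field_simp
    _ = ENNReal.ofReal (k / (k + l)) * Φ.modular μ (fun x => ‖f x‖ / k)
          + ENNReal.ofReal (l / (k + l)) * Φ.modular μ (fun x => ‖g x‖ / l) := by
        rw [lintegral_add_left', lintegral_const_mul' _ _ ENNReal.ofReal_ne_top,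
          lintegral_const_mul' _ _ ENNReal.ofReal_ne_top]
        · rfl
        · exact ((Φ.continuous'.measurable.comp_aemeasurable
            (hfm.norm.aemeasurable.div_const k)).ennreal_ofReal).const_mul _
    _ ≤ 1 := by
        rw [← e1]
        gcongr
        · exact mul_le_of_le_one_right' hf
        · exact mul_le_of_le_one_right' hg

theorem modular_le_of_norm_le {c k : ℝ} (hc : 0 < c) (hk : 0 < k)
    (h : ∀ᵐ x ∂μ, ‖g x‖ ≤ c * ‖f x‖) (hf : Φ.modular μ (fun x => ‖f x‖ / k) ≤ 1) :
    Φ.modular μ (fun x => ‖g x‖ / (c * k)) ≤ 1 := by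
  refine le_trans (modular_mono_ae (fun x => by positivity) (h.mono fun x hx => ?_)) hf
  rw [div_le_div_iff₀ (by positivity) hk]
  nlinarith

theorem memOrlicz_of_norm_le {c : ℝ} (hc : 0 < c) (h : ∀ᵐ x ∂μ, ‖g x‖ ≤ c * ‖f x‖)
    (hf : Φ.MemOrlicz μ f) : Φ.MemOrlicz μ g := by
  obtain ⟨k, hk, hk1⟩ := memOrlicz_iff.1 hf
  exact memOrlicz_iff.2 ⟨c * k, by positivity, modular_le_of_norm_le hc hk h hk1⟩

theorem luxemburgNorm_le_of_norm_le {c : ℝ} (hc : 0 < c) (h : ∀ᵐ x ∂μ, ‖g x‖ ≤ c * ‖f x‖)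
    (hf : Φ.MemOrlicz μ f) : Φ.luxemburgNorm μ g ≤ c * Φ.luxemburgNorm μ f := by
  rw [mul_comm, ← div_le_iff₀ hc]
  refine le_csInf (memOrlicz_iff.1 hf) ?_
  rintro k ⟨hk, hk1⟩
  rw [div_le_iff₀ hc, mul_comm]
  exact luxemburgNorm_le (by positivity) (modular_le_of_norm_le hc hk h hk1)

theorem luxemburgNorm_congr (h : ∀ᵐ x ∂μ, ‖f x‖ = ‖g x‖) :
    Φ.luxemburgNorm μ f = Φ.luxemburgNorm μ g := by
  have : ∀ k : ℝ, Φ.modular μ (fun x => ‖f x‖ / k) = Φ.modular μ (fun x => ‖g x‖ / k) :=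
    fun k => lintegral_congr_ae (h.mono fun x hx => by simp only [hx])
  simp only [luxemburgNorm, this]

theorem memOrlicz_zero : Φ.MemOrlicz μ (fun _ => 0) :=
  ⟨1, one_pos, by simp [modular, Φ.map_zero']⟩

theorem luxemburgNorm_zero : Φ.luxemburgNorm μ (fun _ => 0) = 0 := by
  refine le_antisymm (le_of_forall_pos_le_add fun ε hε => ?_) luxemburgNorm_nonneg
  rw [zero_add]
  exact luxemburgNorm_le hε (by simp [modular, Φ.map_zero'])

theorem MemOrlicz.add (hfm : AEStronglyMeasurable f μ) (hf : Φ.MemOrlicz μ f)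
    (hg : Φ.MemOrlicz μ g) : Φ.MemOrlicz μ (fun x => f x + g x) := by
  obtain ⟨k, hk, hk1⟩ := memOrlicz_iff.1 hf
  obtain ⟨l, hl, hl1⟩ := memOrlicz_iff.1 hg
  exact memOrlicz_iff.2 ⟨k + l, by positivity, modular_add_le hk hl hfm hk1 hl1⟩

theorem luxemburgNorm_add_le (hfm : AEStronglyMeasurable f μ) (hf : Φ.MemOrlicz μ f)
    (hg : Φ.MemOrlicz μ g) :
    Φ.luxemburgNorm μ (fun x => f x + g x) ≤ Φ.luxemburgNorm μ f + Φ.luxemburgNorm μ g := by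
  refine le_of_forall_pos_le_add fun ε hε => ?_
  have hF : 0 ≤ Φ.luxemburgNorm μ f := luxemburgNorm_nonneg
  have hG : 0 ≤ Φ.luxemburgNorm μ g := luxemburgNorm_nonneg
  have := luxemburgNorm_le (by positivity) (modular_add_le (k := Φ.luxemburgNorm μ f + ε / 2)
    (l := Φ.luxemburgNorm μ g + ε / 2) (by positivity) (by positivity) hfm
    (modular_le_one_of_lt hf (by linarith)) (modular_le_one_of_lt hg (by linarith)))
  linarith

theorem ae_eq_zero_of_luxemburgNorm_eq_zero (hfm : AEStronglyMeasurable f μ)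
    (hf : Φ.MemOrlicz μ f) (h0 : Φ.luxemburgNorm μ f = 0) : ∀ᵐ x ∂μ, f x = 0 := by
  -- `μ {|f| ≥ δ} ≤ 1 / N` for every natural number `N ≥ 1`
  have key : ∀ δ : ℝ, 0 < δ → μ {x | δ ≤ ‖f x‖} = 0 := by
    intro δ hδ
    by_contra hne
    have hbound : ∀ N : ℕ, (N : ℝ≥0∞) * μ {x | δ ≤ ‖f x‖} ≤ 1 := by
      intro N
      obtain ⟨t, ht, htN⟩ :=
        ((eventually_gt_atTop (0 : ℝ)).and (Φ.tendsto'.eventually_ge_atTop (N : ℝ))).exists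
      have hm := modular_le_one_of_lt hf (k := δ / t) (by rw [h0]; positivity)
      refine le_trans ?_ ((mul_meas_ge_le_lintegral₀ ?_ (N : ℝ≥0∞)).trans hm)
      · gcongr with x
        intro hx
        rw [← ENNReal.ofReal_natCast]
        refine ENNReal.ofReal_le_ofReal (htN.trans (Φ.mono ht.le ?_))
        rw [le_div_iff₀ (by positivity)]
        calc t * (δ / t) = δ := by field_simp
          _ ≤ _ := hx
      · exact (Φ.continuous'.measurable.comp_aemeasurable
          (hfm.norm.aemeasurable.div_const _)).ennreal_ofReal
    obtain ⟨N, hN⟩ := ENNReal.exists_nat_mul_gt hne ENNReal.one_ne_top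
    exact absurd (hbound N) (not_le.2 hN)
  have hall : ∀ᵐ x ∂μ, ∀ n : ℕ, ¬ (1 / ((n : ℝ) + 1) ≤ ‖f x‖) :=
    ae_all_iff.2 fun n => by
      rw [ae_iff]; simpa using key (1 / ((n : ℝ) + 1)) (by positivity)
  refine hall.mono fun x hx => ?_
  by_contra hne
  obtain ⟨n, hn⟩ := exists_nat_one_div_lt (norm_pos_iff.2 hne)
  exact hx n hn.le

end YoungFunction

/-! ### The Orlicz space -/

section OrliczSpace

variable {α : Type*} [MeasurableSpace α]

/-- The Orlicz space `L^Φ(μ)` of (classes modulo `μ`-a.e. equality of) complex measurable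
functions `f` with `∫ Φ(c |f|) dμ < ∞` for some `c > 0`. -/
def OrliczSpace (Φ : YoungFunction) (μ : Measure α) : Submodule ℂ (α →ₘ[μ] ℂ) where
  carrier := {f | Φ.MemOrlicz μ f}
  zero_mem' := by
    refine YoungFunction.memOrlicz_of_norm_le one_pos ?_ YoungFunction.memOrlicz_zero
    filter_upwards [AEEqFun.coeFn_zero (α := α) (β := ℂ) (μ := μ)] with x hx
    simp [hx]
  add_mem' := by
    intro f g hf hg
    refine YoungFunction.memOrlicz_of_norm_le one_pos ?_
      (YoungFunction.MemOrlicz.add f.aestronglyMeasurable hf hg)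
    filter_upwards [AEEqFun.coeFn_add f g] with x hx
    simp [hx]
  smul_mem' := by
    intro c f hf
    refine YoungFunction.memOrlicz_of_norm_le (c := ‖c‖ + 1) (by positivity) ?_ hf
    filter_upwards [AEEqFun.coeFn_smul c f] with x hx
    rw [hx, Pi.smul_apply, norm_smul]
    gcongr
    linarith

namespace OrliczSpace

variable {Φ : YoungFunction} {μ : Measure α}

/-- The Orlicz space is normed by the Luxemburg norm. -/
instance instNorm : Norm (OrliczSpace Φ μ) := ⟨fun f => Φ.luxemburgNorm μ (f : α →ₘ[μ] ℂ)⟩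

theorem norm_def (f : OrliczSpace Φ μ) : ‖f‖ = Φ.luxemburgNorm μ (f : α →ₘ[μ] ℂ) := rfl

instance instNormedAddCommGroup : NormedAddCommGroup (OrliczSpace Φ μ) :=
  AddGroupNorm.toNormedAddCommGroup
    { toFun := fun f => ‖f‖
      map_zero' := by
        rw [norm_def, ← YoungFunction.luxemburgNorm_zero (Φ := Φ) (μ := μ)]
        refine YoungFunction.luxemburgNorm_congr ?_
        filter_upwards [AEEqFun.coeFn_zero (α := α) (β := ℂ) (μ := μ)] with x hx
        simp [hx]
      add_le' := by
        intro f g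
        refine le_of_eq_of_le ?_ (YoungFunction.luxemburgNorm_add_le
          (f : α →ₘ[μ] ℂ).aestronglyMeasurable f.2 g.2)
        refine YoungFunction.luxemburgNorm_congr ?_
        filter_upwards [AEEqFun.coeFn_add (f : α →ₘ[μ] ℂ) (g : α →ₘ[μ] ℂ)] with x hx
        simp [hx]
      neg' := by
        intro f
        refine YoungFunction.luxemburgNorm_congr ?_
        filter_upwards [AEEqFun.coeFn_neg (f : α →ₘ[μ] ℂ)] with x hx
        simp [hx]
      eq_zero_of_map_eq_zero' := by
        intro f hf
        apply Subtype.ext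
        apply AEEqFun.ext
        filter_upwards [YoungFunction.ae_eq_zero_of_luxemburgNorm_eq_zero
          (f : α →ₘ[μ] ℂ).aestronglyMeasurable f.2 hf,
          AEEqFun.coeFn_zero (α := α) (β := ℂ) (μ := μ)] with x hx hx0
        simp [hx, hx0] }

theorem norm_le_of_ae_le (f g : OrliczSpace Φ μ) {c : ℝ} (hc : 0 < c)
    (h : ∀ᵐ x ∂μ, ‖(g : α →ₘ[μ] ℂ) x‖ ≤ c * ‖(f : α →ₘ[μ] ℂ) x‖) : ‖g‖ ≤ c * ‖f‖ :=
  YoungFunction.luxemburgNorm_le_of_norm_le hc h f.2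

instance instNormedSpace : NormedSpace ℂ (OrliczSpace Φ μ) where
  norm_smul_le := by
    intro c f
    rcases eq_or_ne c 0 with rfl | hc
    · simp
    · refine norm_le_of_ae_le f (c • f) (norm_pos_iff.2 hc) ?_
      filter_upwards [AEEqFun.coeFn_smul c (f : α →ₘ[μ] ℂ)] with x hx
      simp [hx]

end OrliczSpace

end OrliczSpace

/-! ### Topological multiple recurrence -/

/-- A self-map `T` of a topological space is topologically multiply recurrent if for every
positive integer `L` and every nonempty open `U` there is a positive integer `n` with
`U ∩ T⁻ⁿ U ∩ T⁻²ⁿ U ∩ ⋯ ∩ T⁻ᴸⁿ U ≠ ∅`. -/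
def TopologicallyMultiplyRecurrent {X : Type*} [TopologicalSpace X] (T : X → X) : Prop :=
  ∀ L : ℕ, 1 ≤ L → ∀ U : Set X, IsOpen U → U.Nonempty →
    ∃ n : ℕ, 1 ≤ n ∧ (⋂ l ∈ Finset.range (L + 1), (T^[l * n]) ⁻¹' U).Nonempty

/-! ### Weighted translations -/

section WeightedTranslation

set_option linter.unusedSectionVars false

variable {G : Type*} [Group G]

/-- The right translation `f * δ_a`, that is, `(f * δ_a)(x) = f(x a⁻¹)`. -/
def convDirac {β : Type*} (f : G → β) (a : G) : G → β := fun x => f (x * a⁻¹)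

/-- `φ_n = ∏_{j=1}^n w * δ_{a⁻¹}^j`, where `δ_{a⁻¹}^j` is the unit mass at `(a⁻¹)^j`. -/
def weightProd (a : G) (w : G → ℝ) (n : ℕ) : G → ℝ :=
  fun x => ∏ j ∈ Finset.Icc 1 n, convDirac w (a⁻¹ ^ j) x

/-- `φ̃_n = (∏_{j=0}^{n-1} w * δ_a^j)⁻¹`, where `δ_a^j` is the unit mass at `a^j`. -/
def weightProdInv (a : G) (w : G → ℝ) (n : ℕ) : G → ℝ :=
  fun x => (∏ j ∈ Finset.range n, convDirac w (a ^ j) x)⁻¹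

variable [TopologicalSpace G]

/-- `a` is aperiodic if the closed subgroup generated by `a` is not compact. -/
def IsAperiodic [IsTopologicalGroup G] (a : G) : Prop :=
  ¬ IsCompact ((Subgroup.zpowers a).topologicalClosure : Set G)

/-- A weight on `G`: a bounded continuous function with values in `(0, ∞)`. -/
structure IsWeight (w : G → ℝ) : Prop where
  continuous : Continuous w
  pos : ∀ x, 0 < w x
  bddAbove : BddAbove (Set.range w)

variable [IsTopologicalGroup G] [SecondCountableTopology G] [MeasurableSpace G] [BorelSpace G]

/-- The map `f ↦ w · (f * δ_a)` on classes of measurable functions on `G`. -/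
def weightedTranslationAE (lam : Measure G) [lam.IsMulRightInvariant] (a : G) (w : G → ℝ)
    (hw : IsWeight w) (f : G →ₘ[lam] ℂ) : G →ₘ[lam] ℂ :=
  AEEqFun.mk (fun x => (w x : ℂ))
      (Complex.continuous_ofReal.comp hw.continuous).aestronglyMeasurable *
    f.compMeasurePreserving (fun x => x * a⁻¹) (measurePreserving_mul_right lam a⁻¹)

theorem coeFn_weightedTranslationAE (lam : Measure G) [lam.IsMulRightInvariant] (a : G)
    (w : G → ℝ) (hw : IsWeight w) (f : G →ₘ[lam] ℂ) :
    ∀ᵐ x ∂lam, weightedTranslationAE lam a w hw f x = w x * convDirac f a x := by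
  filter_upwards [AEEqFun.coeFn_mul (AEEqFun.mk (fun x => (w x : ℂ))
      (Complex.continuous_ofReal.comp hw.continuous).aestronglyMeasurable)
      (f.compMeasurePreserving (fun x => x * a⁻¹) (measurePreserving_mul_right lam a⁻¹)),
    AEEqFun.coeFn_mk (μ := lam) (fun x => (w x : ℂ))
      (Complex.continuous_ofReal.comp hw.continuous).aestronglyMeasurable,
    f.coeFn_compMeasurePreserving (measurePreserving_mul_right lam a⁻¹)] with x h1 h2 h3
  rw [weightedTranslationAE, h1, Pi.mul_apply, h2, h3]
  rfl

theorem modular_convDirac (Φ : YoungFunction) (lam : Measure G) [lam.IsMulRightInvariant]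
    (a : G) (u : G → ℝ) : Φ.modular lam (fun x => u (x * a⁻¹)) = Φ.modular lam u :=
  lintegral_mul_right_eq_self (fun x => ENNReal.ofReal (Φ (u x))) a⁻¹

theorem memOrlicz_convDirac {Φ : YoungFunction} {lam : Measure G} [lam.IsMulRightInvariant]
    (a : G) {f : G → ℂ} (hf : Φ.MemOrlicz lam f) : Φ.MemOrlicz lam (convDirac f a) := by
  obtain ⟨c, hc, h⟩ := hf
  exact ⟨c, hc, (modular_convDirac Φ lam a fun x => c * ‖f x‖).trans_lt h⟩

theorem luxemburgNorm_convDirac (Φ : YoungFunction) (lam : Measure G)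
    [lam.IsMulRightInvariant] (a : G) (f : G → ℂ) :
    Φ.luxemburgNorm lam (convDirac f a) = Φ.luxemburgNorm lam f := by
  have : ∀ k : ℝ, Φ.modular lam (fun x => ‖convDirac f a x‖ / k)
      = Φ.modular lam (fun x => ‖f x‖ / k) :=
    fun k => modular_convDirac Φ lam a fun x => ‖f x‖ / k
  simp only [YoungFunction.luxemburgNorm, this]

theorem IsWeight.exists_bound {w : G → ℝ} (hw : IsWeight w) : ∃ C : ℝ, 0 < C ∧ ∀ x, w x ≤ C := by
  obtain ⟨C, hC⟩ := hw.bddAbove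
  exact ⟨C, (hw.pos 1).trans_le (hC ⟨1, rfl⟩), fun x => hC ⟨x, rfl⟩⟩

theorem norm_weightedTranslationAE_le (lam : Measure G) [lam.IsMulRightInvariant] (a : G)
    {w : G → ℝ} (hw : IsWeight w) {C : ℝ} (hC : ∀ x, w x ≤ C) (f : G →ₘ[lam] ℂ) :
    ∀ᵐ x ∂lam, ‖weightedTranslationAE lam a w hw f x‖ ≤ C * ‖convDirac f a x‖ := by
  filter_upwards [coeFn_weightedTranslationAE lam a w hw f] with x hx
  rw [hx, norm_mul, Complex.norm_real, Real.norm_of_nonneg (hw.pos x).le]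
  gcongr
  exact hC x

/-- The weighted translation `T_{a,w} f = w · (f * δ_a)` on the Orlicz space `L^Φ(G)`, as a
linear operator. -/
def weightedTranslationLinear (Φ : YoungFunction) (lam : Measure G) [lam.IsMulRightInvariant]
    (a : G) (w : G → ℝ) (hw : IsWeight w) : OrliczSpace Φ lam →ₗ[ℂ] OrliczSpace Φ lam where
  toFun f := ⟨weightedTranslationAE lam a w hw f, by
    obtain ⟨C, hC0, hC⟩ := hw.exists_bound
    exact YoungFunction.memOrlicz_of_norm_le hC0 (norm_weightedTranslationAE_le lam a hw hC f)
      (memOrlicz_convDirac a f.2)⟩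
  map_add' f g := by
    apply Subtype.ext
    have h := (measurePreserving_mul_right lam a⁻¹).quasiMeasurePreserving.ae
      (AEEqFun.coeFn_add (f : G →ₘ[lam] ℂ) (g : G →ₘ[lam] ℂ))
    apply AEEqFun.ext
    filter_upwards [h, coeFn_weightedTranslationAE lam a w hw (f + g : G →ₘ[lam] ℂ),
      coeFn_weightedTranslationAE lam a w hw f, coeFn_weightedTranslationAE lam a w hw g,
      AEEqFun.coeFn_add (weightedTranslationAE lam a w hw f)
        (weightedTranslationAE lam a w hw g)] with x h h1 h2 h3 h4
    simp only [Submodule.coe_add]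
    rw [h1, h4, Pi.add_apply, h2, h3, convDirac, h, Pi.add_apply, mul_add]
    rfl
  map_smul' c f := by
    apply Subtype.ext
    have h := (measurePreserving_mul_right lam a⁻¹).quasiMeasurePreserving.ae
      (AEEqFun.coeFn_smul c (f : G →ₘ[lam] ℂ))
    apply AEEqFun.ext
    filter_upwards [h, coeFn_weightedTranslationAE lam a w hw (c • f : G →ₘ[lam] ℂ),
      coeFn_weightedTranslationAE lam a w hw f,
      AEEqFun.coeFn_smul c (weightedTranslationAE lam a w hw f)] with x h h1 h2 h3
    simp only [Submodule.coe_smul, RingHom.id_apply]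
    rw [h1, h3, Pi.smul_apply, h2, convDirac, h, Pi.smul_apply, smul_eq_mul, smul_eq_mul,
      mul_left_comm]
    rfl

/-- The weighted translation `T_{a,w}` on `L^Φ(G)`, as a bounded linear operator. -/
def weightedTranslation (Φ : YoungFunction) (lam : Measure G) [lam.IsMulRightInvariant]
    (a : G) (w : G → ℝ) (hw : IsWeight w) : OrliczSpace Φ lam →L[ℂ] OrliczSpace Φ lam :=
  LinearMap.mkContinuousOfExistsBound (weightedTranslationLinear Φ lam a w hw) <| by
    obtain ⟨C, hC0, hC⟩ := hw.exists_bound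
    refine ⟨C, fun f => ?_⟩
    refine (YoungFunction.luxemburgNorm_le_of_norm_le hC0
      (norm_weightedTranslationAE_le lam a hw hC f) (memOrlicz_convDirac a f.2)).trans ?_
    rw [luxemburgNorm_convDirac]
    rfl

/-- The defining formula `(T_{a,w} f)(x) = w(x) f(x a⁻¹)`. -/
theorem weightedTranslation_apply_ae (Φ : YoungFunction) (lam : Measure G)
    [lam.IsMulRightInvariant] (a : G) (w : G → ℝ) (hw : IsWeight w) (f : OrliczSpace Φ lam) :
    ∀ᵐ x ∂lam, (weightedTranslation Φ lam a w hw f : G →ₘ[lam] ℂ) x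
      = w x * (f : G →ₘ[lam] ℂ) (x * a⁻¹) :=
  coeFn_weightedTranslationAE lam a w hw f

end WeightedTranslation

end

/-! Everything rests on the identity `(T^n f)(x a^n) = φ_n(x) f(x)`. Since the Luxemburg norm is
invariant under right translation, a bound for `φ_n` on the support of `f` bounds `‖T^n f‖ / ‖f‖`.
The inverse `S` of `T` is again a weighted translation, by `a⁻¹`, and its weight products are the
`φ̃_n`.

(i) ⇒ (ii): recurrence near the indicator of `K` gives `f` such that `f` and all `T^{ln} f` are
norm-close to it, hence pointwise close off a set of small measure. For large `n`, aperiodicity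
makes `K a^{ln}` disjoint from `K` (`isCompact_topologicalClosure_zpowers`). At a good `x ∈ K`,
`f(x)` is near 1 while `(T^{ln} f)(x a^{ln})` is near 0, so `φ_{ln}(x)` is small; `(T^{ln} f)(x)` is
near 1 while `f(x a^{-ln})` is near 0, so `φ̃_{ln}(x)` is small. This is
`exists_measurableSet_weightProd_le`.

(ii) ⇒ (i): doubling makes bounded compactly supported functions dense
(`exists_bounded_compactSupport_norm_sub_le`). Truncate such a `g` to `E_k` and take `v = ∑_{m ≤ L}
S^{mn} g`. In `T^{ln} v` the term `m = l` is `g`; each other term is a `T^{jn} g` or `S^{jn} g` with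
`1 ≤ j ≤ L`, which is small (`exists_forall_norm_iterate_sub_le`). -/

namespace YoungFunction

/-! ### Modular estimates. -/

variable {α : Type*} [MeasurableSpace α] {Φ : YoungFunction} {μ : Measure α} {f : α → ℂ}

theorem map_two_pow_mul_le {M : ℝ} (hM : 0 < M) (h : ∀ t > 0, Φ (2 * t) ≤ M * Φ t) (n : ℕ)
    {t : ℝ} (ht : 0 ≤ t) : Φ (2 ^ n * t) ≤ M ^ n * Φ t := by
  rcases ht.eq_or_lt with rfl | ht
  · simp [Φ.map_zero']
  induction n with
  | zero => simp
  | succ n ih =>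
    calc Φ (2 ^ (n + 1) * t) = Φ (2 * (2 ^ n * t)) := by ring_nf
      _ ≤ M * Φ (2 ^ n * t) := h _ (by positivity)
      _ ≤ M * (M ^ n * Φ t) := by gcongr
      _ = M ^ (n + 1) * Φ t := by ring

/-- Under the global doubling condition the modular of an Orlicz function is finite at every
scale. -/
theorem MemOrlicz.modular_div_lt_top {M : ℝ} (hM : 0 < M) (h : ∀ t > 0, Φ (2 * t) ≤ M * Φ t)
    (hf : Φ.MemOrlicz μ f) {k : ℝ} (hk : 0 < k) :
    Φ.modular μ (fun x => ‖f x‖ / k) < ∞ := by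
  obtain ⟨c, hc, hlt⟩ := hf
  -- With `1 / k < 2^n c`, the function `|f| / k` lies below `2^n (c |f|)`, and `n` doublings cost
  -- the factor `M^n`.
  obtain ⟨n, hn⟩ := pow_unbounded_of_one_lt (1 / (k * c)) (one_lt_two : (1 : ℝ) < 2)
  calc Φ.modular μ (fun x => ‖f x‖ / k)
      ≤ ∫⁻ x, ENNReal.ofReal (M ^ n) * ENNReal.ofReal (Φ (c * ‖f x‖)) ∂μ := by
        refine lintegral_mono fun x => ?_
        rw [← ENNReal.ofReal_mul (by positivity)]
        refine ENNReal.ofReal_le_ofReal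
          ((Φ.mono (by positivity) ?_).trans (map_two_pow_mul_le hM h n (by positivity)))
        rw [div_lt_iff₀ (by positivity)] at hn
        rw [div_le_iff₀ hk]
        nlinarith [norm_nonneg (f x)]
    _ = ENNReal.ofReal (M ^ n) * Φ.modular μ (fun x => c * ‖f x‖) :=
        lintegral_const_mul' _ _ ENNReal.ofReal_ne_top
    _ < ∞ := ENNReal.mul_lt_top ENNReal.ofReal_lt_top hlt

/-- For bounded functions, a support of small measure alone makes the modular small at any fixed
scale. -/
theorem modular_div_le_of_bounded {A : Set α} (hA : MeasurableSet A) {R k : ℝ} (hk : 0 < k)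
    (hb : ∀ᵐ x ∂μ, ‖f x‖ ≤ R) (h0 : ∀ᵐ x ∂μ, x ∉ A → f x = 0) :
    Φ.modular μ (fun x => ‖f x‖ / k) ≤ ENNReal.ofReal (Φ (R / k)) * μ A := by
  rw [← lintegral_indicator_const hA]
  refine lintegral_mono_ae ?_
  filter_upwards [hb, h0] with x hx hx0
  by_cases hxA : x ∈ A
  · rw [Set.indicator_of_mem hxA]
    exact ENNReal.ofReal_le_ofReal (Φ.mono (by positivity) (by gcongr))
  · simp [hx0 hxA, Φ.map_zero']

/-- A Markov inequality for the Luxemburg norm. -/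
theorem measure_norm_ge_le {ε : ℝ} (hε : 0 < ε) (hfm : AEStronglyMeasurable f μ)
    (hf : Φ.MemOrlicz μ f) (h : Φ.luxemburgNorm μ f < ε ^ 2) :
    μ {x | ε ≤ ‖f x‖} ≤ (ENNReal.ofReal (Φ (1 / ε)))⁻¹ := by
  have hpos : 0 < Φ (1 / ε) := Φ.pos' _ (by positivity)
  rw [← one_div, ENNReal.le_div_iff_mul_le (Or.inl (by simpa using hpos))
    (Or.inl ENNReal.ofReal_ne_top), mul_comm]
  -- At scale `ε²` the modular is at most 1, and where `|f| ≥ ε` its integrand is at least `Φ(1/ε)`.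
  -- The square is what makes the bound vanish as `ε → 0`.
  refine le_trans ?_ ((mul_meas_ge_le_lintegral₀ ?_ (ENNReal.ofReal (Φ (1 / ε)))).trans
    (modular_le_one_of_lt hf h))
  · gcongr with x
    intro hx
    refine ENNReal.ofReal_le_ofReal (Φ.mono (by positivity) ?_)
    rw [div_le_div_iff₀ hε (by positivity)]
    have : ε ≤ ‖f x‖ := hx
    nlinarith
  · exact (Φ.continuous'.measurable.comp_aemeasurable
      (hfm.norm.aemeasurable.div_const _)).ennreal_ofReal

theorem tendsto_inv_ofReal_apply_inv (Φ : YoungFunction) {u : ℕ → ℝ}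
    (hu : Tendsto u atTop atTop) :
    Tendsto (fun k => (ENNReal.ofReal (Φ (u k)))⁻¹) atTop (𝓝 0) := by
  rw [← ENNReal.inv_top]
  exact (ENNReal.tendsto_ofReal_nhds_top.2 (Φ.tendsto'.comp hu)).inv

end YoungFunction

/-! ### Truncation and density in the Orlicz space. -/

namespace OrliczSpace

variable {α : Type*} [MeasurableSpace α] {Φ : YoungFunction} {μ : Measure α}

/-- The class in `L^Φ(μ)` of a function satisfying the Orlicz integrability condition. -/
noncomputable def mk (f : α → ℂ) (hfm : AEStronglyMeasurable f μ) (hf : Φ.MemOrlicz μ f) :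
    OrliczSpace Φ μ :=
  ⟨AEEqFun.mk f hfm, YoungFunction.memOrlicz_of_norm_le one_pos
    ((AEEqFun.coeFn_mk f hfm).mono fun x hx => by rw [hx, one_mul]) hf⟩

theorem coeFn_mk (f : α → ℂ) (hfm : AEStronglyMeasurable f μ) (hf : Φ.MemOrlicz μ f) :
    ((mk f hfm hf : OrliczSpace Φ μ) : α →ₘ[μ] ℂ) =ᵐ[μ] f :=
  AEEqFun.coeFn_mk f hfm

theorem coeFn_sub (f g : OrliczSpace Φ μ) :
    ((f - g : OrliczSpace Φ μ) : α →ₘ[μ] ℂ) =ᵐ[μ]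
      fun x => (f : α →ₘ[μ] ℂ) x - (g : α →ₘ[μ] ℂ) x :=
  AEEqFun.coeFn_sub (f : α →ₘ[μ] ℂ) (g : α →ₘ[μ] ℂ)

theorem norm_le_of_modular_le_one (f : OrliczSpace Φ μ) {u : α → ℂ} {k : ℝ} (hk : 0 < k)
    (hu : (f : α →ₘ[μ] ℂ) =ᵐ[μ] u) (h : Φ.modular μ (fun x => ‖u x‖ / k) ≤ 1) : ‖f‖ ≤ k := by
  rw [norm_def, YoungFunction.luxemburgNorm_congr (hu.mono fun x hx => by rw [hx])]
  exact YoungFunction.luxemburgNorm_le hk h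

/-- The truncation of an element of `L^Φ(μ)` to a measurable set. -/
noncomputable def truncate (f : OrliczSpace Φ μ) {E : Set α} (hE : MeasurableSet E) : OrliczSpace Φ μ :=
  mk (E.indicator (f : α →ₘ[μ] ℂ)) ((f : α →ₘ[μ] ℂ).aestronglyMeasurable.indicator hE)
    (YoungFunction.memOrlicz_of_norm_le one_pos
      (Eventually.of_forall fun x => by
        rw [one_mul]; exact norm_indicator_le_norm_self _ _) f.2)

theorem coeFn_truncate (f : OrliczSpace Φ μ) {E : Set α} (hE : MeasurableSet E) :
    (truncate f hE : α →ₘ[μ] ℂ) =ᵐ[μ] E.indicator (f : α →ₘ[μ] ℂ) :=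
  coeFn_mk _ _ _

theorem norm_truncate_le (f : OrliczSpace Φ μ) {E : Set α} (hE : MeasurableSet E) :
    ‖truncate f hE‖ ≤ ‖f‖ := by
  rw [← one_mul ‖f‖]
  refine norm_le_of_ae_le f _ one_pos ?_
  filter_upwards [coeFn_truncate f hE] with x hx
  rw [hx, one_mul]
  exact norm_indicator_le_norm_self _ _

theorem coeFn_sub_truncate (f : OrliczSpace Φ μ) {E : Set α} (hE : MeasurableSet E) :
    ((f - truncate f hE : OrliczSpace Φ μ) : α →ₘ[μ] ℂ) =ᵐ[μ]
      Eᶜ.indicator (f : α →ₘ[μ] ℂ) := by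
  filter_upwards [coeFn_truncate f hE, coeFn_sub f (truncate f hE)] with x h1 h2
  rw [h2, h1]
  by_cases hx : x ∈ E <;> simp [hx]

/-- Under the global doubling condition, the bounded functions with compact support are dense
in `L^Φ(μ)`. -/
theorem exists_bounded_compactSupport_norm_sub_le [TopologicalSpace α] [T2Space α]
    [SigmaCompactSpace α] [OpensMeasurableSpace α] {M : ℝ} (hM : 0 < M)
    (h : ∀ t > 0, Φ (2 * t) ≤ M * Φ t) (f : OrliczSpace Φ μ) {ε : ℝ} (hε : 0 < ε) :
    ∃ (g : OrliczSpace Φ μ) (K : Set α) (R : ℝ), IsCompact K ∧ ‖f - g‖ ≤ ε ∧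
      (∀ᵐ x ∂μ, ‖(g : α →ₘ[μ] ℂ) x‖ ≤ R) ∧
      (∀ᵐ x ∂μ, x ∉ K → (g : α →ₘ[μ] ℂ) x = 0) := by
  set u : α → ℂ := ((f : α →ₘ[μ] ℂ) : α → ℂ) with hu
  have hum : Measurable u := (f : α →ₘ[μ] ℂ).stronglyMeasurable.measurable
  let E : ℕ → Set α := fun j => compactCovering α j ∩ {x | ‖u x‖ ≤ j}
  have hE : ∀ j, MeasurableSet (E j) := fun j =>
    (isCompact_compactCovering α j).measurableSet.inter
      (measurableSet_le hum.norm measurable_const)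
  -- A norm at most `ε` only requires the modular at scale `ε` to drop below 1. Dominated
  -- convergence gives this, the majorant being integrable by doubling.
  have hlim : Tendsto (fun j => Φ.modular μ (fun x => ‖(E j)ᶜ.indicator u x‖ / ε)) atTop
      (𝓝 (∫⁻ _, 0 ∂μ)) := by
    refine tendsto_lintegral_of_dominated_convergence
      (fun x => ENNReal.ofReal (Φ (‖u x‖ / ε))) (fun j => ?_) (fun j => ?_) ?_ ?_
    · exact (Φ.continuous'.measurable.comp
        ((hum.indicator (hE j).compl).norm.div_const _)).ennreal_ofReal
    · refine Eventually.of_forall fun x =>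
        ENNReal.ofReal_le_ofReal (Φ.mono (by positivity) ?_)
      exact div_le_div_of_nonneg_right (norm_indicator_le_norm_self _ _) hε.le
    · exact (YoungFunction.MemOrlicz.modular_div_lt_top hM h f.2 hε).ne
    · refine Eventually.of_forall fun x => tendsto_const_nhds.congr' ?_
      obtain ⟨j₀, hj₀⟩ := exists_mem_compactCovering x
      obtain ⟨j₁, hj₁⟩ := exists_nat_ge ‖u x‖
      filter_upwards [eventually_ge_atTop j₀, eventually_ge_atTop j₁] with j h0 h1
      have : x ∈ E j := ⟨compactCovering_subset α h0 hj₀,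
        hj₁.trans (by exact_mod_cast h1)⟩
      simp [this, Φ.map_zero']
  rw [lintegral_zero] at hlim
  obtain ⟨j, hj⟩ := (hlim.eventually_le_const zero_lt_one).exists
  refine ⟨truncate f (hE j), compactCovering α j, j, isCompact_compactCovering α j,
    norm_le_of_modular_le_one _ hε (coeFn_sub_truncate f (hE j)) hj, ?_, ?_⟩
  · filter_upwards [coeFn_truncate f (hE j)] with x hx
    rw [hx]
    by_cases hxE : x ∈ E j
    · rw [Set.indicator_of_mem hxE]; exact hxE.2
    · simp [hxE]
  · filter_upwards [coeFn_truncate f (hE j)] with x hx hxK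
    rw [hx, Set.indicator_of_notMem fun hxE => hxK hxE.1]

end OrliczSpace

/-! ### Powers of an aperiodic element. -/

/-- If the powers of `a` return to a compact set infinitely often, then the closed subgroup
generated by `a` is compact. -/
theorem isCompact_topologicalClosure_zpowers {G : Type*} [Group G] [TopologicalSpace G]
    [IsTopologicalGroup G] [LocallyCompactSpace G] {a : G} {C : Set G}
    (hC : IsCompact C) (h : ∃ᶠ n : ℕ in atTop, a ^ n ∈ C) :
    IsCompact ((Subgroup.zpowers a).topologicalClosure : Set G) := by
  -- arbitrarily large powers of `a` come close to `1`
  have hret : ∀ V ∈ 𝓝 (1 : G), ∀ N : ℕ, ∃ m : ℕ, N ≤ m ∧ a ^ m ∈ V := by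
    intro V hV N
    -- Two visits `a^i`, `a^j` near a cluster point, with `j ≥ i + N`, have quotient `a^{j-i}` near
    -- 1.
    obtain ⟨c, -, hc⟩ : ∃ c ∈ C, MapClusterPt c atTop (fun n : ℕ => a ^ n) :=
      hC.exists_mapClusterPt_of_frequently h
    have hdiv : Tendsto (fun p : G × G => p.1⁻¹ * p.2) (𝓝 c ×ˢ 𝓝 c) (𝓝 1) := by
      have : Continuous fun p : G × G => p.1⁻¹ * p.2 := by fun_prop
      simpa [nhds_prod_eq] using this.tendsto (c, c)
    obtain ⟨W, hW, hWV⟩ := mem_prod_same_iff.1 (hdiv hV)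
    obtain ⟨i, hi⟩ := (mapClusterPt_iff_frequently.1 hc W hW).exists
    obtain ⟨j, hji, hj⟩ := (frequently_atTop.1 (mapClusterPt_iff_frequently.1 hc W hW)) (i + N)
    refine ⟨j - i, by omega, ?_⟩
    have : a ^ (j - i) = (a ^ i)⁻¹ * a ^ j := by
      rw [eq_inv_mul_iff_mul_eq, ← pow_add]; congr 1; omega
    rw [this]
    exact hWV (Set.mk_mem_prod hi hj)
  set H := (Subgroup.zpowers a).topologicalClosure with hH
  have hHc : IsClosed (H : Set G) := Subgroup.isClosed_topologicalClosure _
  have haH : a ∈ H := Subgroup.le_topologicalClosure _ (Subgroup.mem_zpowers a)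
  -- hence positive and negative powers of `a` are both dense in the closed subgroup
  have hdense : ∀ x ∈ H, ∀ V ∈ 𝓝 (1 : G),
      (∃ n : ℕ, a ^ n * x ∈ V) ∧ ∃ n : ℕ, 1 ≤ n ∧ (a ^ n)⁻¹ * x ∈ V := by
    intro x hx V hV
    obtain ⟨W, hW, hWV⟩ := exists_nhds_one_split hV
    have hx' : {y : G | y⁻¹ * x ∈ W} ∈ 𝓝 x := by
      have : Continuous fun y : G => y⁻¹ * x := by fun_prop
      exact this.continuousAt.preimage_mem_nhds (by simpa using hW)
    obtain ⟨y, hyW, k, rfl⟩ := mem_closure_iff_nhds.1 hx _ hx'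
    -- Here `a^k` is close to `x`, and multiplying by `a^m` or `a^{-m}`, both near 1, barely
    -- matters. The bound `m ≥ 1 + |k|` gives `m - k` and `m + k` the required signs.
    obtain ⟨m, hm, hmW, hmW'⟩ := hret _ (inter_mem hW (inv_mem_nhds_one G hW)) (1 + k.natAbs)
    refine ⟨⟨(m - k).toNat, ?_⟩, (m + k).toNat, by omega, ?_⟩
    · have : a ^ (m - k).toNat * x = a ^ m * ((a ^ k)⁻¹ * x) := by
        rw [← zpow_natCast a, Int.toNat_of_nonneg (by omega), zpow_sub, zpow_natCast, mul_assoc]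
      rw [this]
      exact hWV _ hmW _ hyW
    · have : (a ^ (m + k).toNat)⁻¹ * x = (a ^ m)⁻¹ * ((a ^ k)⁻¹ * x) := by
        rw [← zpow_natCast a, Int.toNat_of_nonneg (by omega), add_comm, zpow_add, zpow_natCast,
          mul_inv_rev, mul_assoc]
      rw [this]
      exact hWV _ hmW' _ hyW
  obtain ⟨V, hVc, hV1⟩ := exists_compact_mem_nhds (1 : G)
  -- The exponents `i + 1` are positive so that each return to `V` can be undone by a strictly
  -- smaller power.
  have hcover : (V ∩ H : Set G) ⊆ ⋃ i : ℕ, {y | (a ^ (i + 1))⁻¹ * y ∈ interior V} := by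
    rintro x ⟨-, hx⟩
    obtain ⟨n, hn, hnx⟩ := (hdense x hx _ (interior_mem_nhds.2 hV1)).2
    refine Set.mem_iUnion.2 ⟨n - 1, ?_⟩
    rwa [Set.mem_ofPred_eq, Nat.sub_add_cancel hn]
  obtain ⟨t, ht⟩ := (hVc.inter_right hHc).elim_finite_subcover _
    (fun i => isOpen_interior.preimage (by fun_prop)) hcover
  obtain ⟨N, hN⟩ := t.bddAbove
  -- Take the least `n` with `a^n x ∈ V`. The finite subcover gives `a^{n-(i+1)} x ∈ V` for some `i
  -- ≤ N`; if `n > N` this contradicts minimality. So finitely many translates of `V` cover `H`.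
  have hsub : (H : Set G) ⊆ ⋃ n ∈ Set.Iic N, (fun y => (a ^ n)⁻¹ * y) '' V := by
    classical
    intro x hx
    have hex : ∃ n : ℕ, a ^ n * x ∈ V := (hdense x hx V hV1).1
    have hmem := Nat.find_spec hex
    set n := Nat.find hex with hn
    refine Set.mem_biUnion (x := n) ?_ ⟨_, hmem, by simp⟩
    obtain ⟨i, hit, hi⟩ := Set.mem_iUnion₂.1 (ht ⟨hmem, H.mul_mem (H.pow_mem haH n) hx⟩)
    have hiN : i ≤ N := hN hit
    by_contra hlt
    simp only [Set.mem_Iic, not_le] at hlt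
    refine Nat.find_min hex (m := n - (i + 1)) (by omega) ?_
    have : a ^ (n - (i + 1)) * x = (a ^ (i + 1))⁻¹ * (a ^ n * x) := by
      rw [eq_inv_mul_iff_mul_eq, ← mul_assoc, ← pow_add, Nat.add_sub_cancel' (by omega)]
    rw [this]
    exact interior_subset hi
  exact ((Set.finite_Iic N).isCompact_biUnion fun n _ =>
    hVc.image (by fun_prop)).of_isClosed_subset hHc hsub

/-- The translates of a compact set by large powers of an aperiodic element are disjoint from
it. -/
theorem IsAperiodic.eventually_mul_pow_notMem {G : Type*} [Group G] [TopologicalSpace G]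
    [IsTopologicalGroup G] [LocallyCompactSpace G] {a : G} (ha : IsAperiodic a) {K : Set G}
    (hK : IsCompact K) : ∀ᶠ n : ℕ in atTop, ∀ x ∈ K, x * a ^ n ∉ K := by
  by_contra hcon
  refine ha (isCompact_topologicalClosure_zpowers (hK.inv.mul hK) ?_)
  refine (not_eventually.1 hcon).mono fun n hn => ?_
  push Not at hn
  obtain ⟨x, hx, hxn⟩ := hn
  exact ⟨x⁻¹, Set.inv_mem_inv.2 hx, x * a ^ n, hxn, by simp⟩

/-- This selects the global clause of `Δ₂`-regularity. -/
theorem IsAperiodic.not_compactSpace {G : Type*} [Group G] [TopologicalSpace G]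
    [IsTopologicalGroup G] {a : G} (ha : IsAperiodic a) : ¬ CompactSpace G := fun _ =>
  ha (Subgroup.isClosed_topologicalClosure _).isCompact

theorem ae_mul_right {G : Type*} [Group G] [MeasurableSpace G] [MeasurableMul G]
    {lam : Measure G} [lam.IsMulRightInvariant] (b : G) {p : G → Prop}
    (h : ∀ᵐ x ∂lam, p x) : ∀ᵐ x ∂lam, p (x * b) :=
  (measurePreserving_mul_right lam b).quasiMeasurePreserving.ae h

/-! ### Iterates of the weighted translation and its inverse. -/

section WeightedTranslation

variable {G : Type*} [Group G]

theorem weightProd_eq_prod_range_succ (a : G) (w : G → ℝ) (n : ℕ) (x : G) :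
    weightProd a w n x = ∏ j ∈ Finset.range n, w (x * a ^ (j + 1)) := by
  rw [weightProd, ← Finset.Ico_add_one_right_eq_Icc, Finset.prod_Ico_eq_prod_range]
  simp [convDirac, add_comm]

/-- Reversing the order of the factors turns `φ_n(x)` into the product produced by `T^n` at the
point `x a^n`. -/
theorem weightProd_eq_prod_range (a : G) (w : G → ℝ) (n : ℕ) (x : G) :
    weightProd a w n x = ∏ j ∈ Finset.range n, w (x * a ^ n * (a ^ j)⁻¹) := by
  rw [weightProd_eq_prod_range_succ, ← Finset.prod_range_reflect]
  refine Finset.prod_congr rfl fun j hj => ?_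
  rw [Finset.mem_range] at hj
  rw [mul_assoc, ← pow_sub a hj.le]
  congr 3
  omega

theorem weightProd_pos (a : G) {w : G → ℝ} (hw : ∀ x, 0 < w x) (n : ℕ) (x : G) :
    0 < weightProd a w n x :=
  Finset.prod_pos fun _ _ => hw _

theorem weightProdInv_pos (a : G) {w : G → ℝ} (hw : ∀ x, 0 < w x) (n : ℕ) (x : G) :
    0 < weightProdInv a w n x :=
  inv_pos.2 (Finset.prod_pos fun _ _ => hw _)

/-- The weight of the inverse of the weighted translation `T_{a,w}`. -/
noncomputable def inverseWeight (a : G) (w : G → ℝ) : G → ℝ := fun x => (w (x * a))⁻¹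

/-- Through this identity, estimates for `T` in terms of `φ_n` become estimates for its inverse in
terms of `φ̃_n`. -/
theorem weightProd_inv_inverseWeight (a : G) (w : G → ℝ) (n : ℕ) (x : G) :
    weightProd a⁻¹ (inverseWeight a w) n x = weightProdInv a w n x := by
  rw [weightProd_eq_prod_range_succ, weightProdInv, ← Finset.prod_inv_distrib]
  refine Finset.prod_congr rfl fun j _ => ?_
  simp [inverseWeight, convDirac, pow_succ, mul_assoc]

variable [TopologicalSpace G]

theorem IsWeight.inverseWeight [IsTopologicalGroup G] {w : G → ℝ} (hw : IsWeight w)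
    (hw_inv : BddAbove (Set.range fun x => (w x)⁻¹)) (a : G) :
    IsWeight (inverseWeight a w) where
  continuous := (hw.continuous.comp (continuous_mul_const a)).inv₀ fun x => (hw.pos _).ne'
  pos x := inv_pos.2 (hw.pos _)
  bddAbove := hw_inv.mono (by rintro _ ⟨x, rfl⟩; exact ⟨x * a, rfl⟩)

variable [IsTopologicalGroup G] [SecondCountableTopology G] [MeasurableSpace G] [BorelSpace G]
  {lam : Measure G} [lam.IsMulRightInvariant] {Φ : YoungFunction} {a : G} {w : G → ℝ}

theorem weightedTranslation_iterate_apply_ae (hw : IsWeight w) (n : ℕ) (f : OrliczSpace Φ lam) :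
    ∀ᵐ x ∂lam, ((weightedTranslation Φ lam a w hw)^[n] f : G →ₘ[lam] ℂ) x
      = (∏ j ∈ Finset.range n, w (x * (a ^ j)⁻¹) : ℝ) * (f : G →ₘ[lam] ℂ) (x * (a ^ n)⁻¹) := by
  induction n with
  | zero => simp
  | succ n ih =>
    rw [Function.iterate_succ_apply']
    filter_upwards [weightedTranslation_apply_ae Φ lam a w hw
      ((weightedTranslation Φ lam a w hw)^[n] f), ae_mul_right a⁻¹ ih] with x h1 h2
    rw [h1, h2, Finset.prod_range_succ', ← mul_assoc, ← Complex.ofReal_mul, mul_comm (w x)]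
    simp only [pow_zero, inv_one, mul_one, pow_succ, mul_inv_rev, mul_assoc]

theorem weightedTranslation_iterate_apply_mul_pow_ae (hw : IsWeight w) (n : ℕ)
    (f : OrliczSpace Φ lam) :
    ∀ᵐ x ∂lam, ((weightedTranslation Φ lam a w hw)^[n] f : G →ₘ[lam] ℂ) (x * a ^ n)
      = weightProd a w n x * (f : G →ₘ[lam] ℂ) x := by
  filter_upwards [ae_mul_right (a ^ n) (weightedTranslation_iterate_apply_ae hw n f)] with x hx
  rw [hx, weightProd_eq_prod_range, mul_inv_cancel_right]

/-- A bound of `φ_n` on the support of `f` bounds the norm of `T_{a,w}^n f`. -/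
theorem norm_weightedTranslation_iterate_le (hw : IsWeight w) (n : ℕ) (f : OrliczSpace Φ lam)
    {c : ℝ} (hc : 0 < c)
    (h : ∀ᵐ x ∂lam, (f : G →ₘ[lam] ℂ) x ≠ 0 → weightProd a w n x ≤ c) :
    ‖(weightedTranslation Φ lam a w hw)^[n] f‖ ≤ c * ‖f‖ := by
  rw [OrliczSpace.norm_def, OrliczSpace.norm_def,
    ← luxemburgNorm_convDirac Φ lam (a ^ n) (f : G →ₘ[lam] ℂ)]
  refine YoungFunction.luxemburgNorm_le_of_norm_le hc ?_ (memOrlicz_convDirac _ f.2)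
  filter_upwards [ae_mul_right (a ^ n)⁻¹
    ((weightedTranslation_iterate_apply_mul_pow_ae (a := a) hw n f).and h)] with x ⟨h1, h2⟩
  rw [inv_mul_cancel_right] at h1
  rw [h1, norm_mul, Complex.norm_real, Real.norm_of_nonneg (weightProd_pos a hw.pos _ _).le,
    convDirac]
  by_cases h0 : (f : G →ₘ[lam] ℂ) (x * (a ^ n)⁻¹) = 0
  · simp [h0]
  · gcongr
    exact h2 h0

theorem weightedTranslation_rightInverse (hw : IsWeight w)
    (hw' : IsWeight (inverseWeight a w)) :
    Function.RightInverse (weightedTranslation Φ lam a⁻¹ (inverseWeight a w) hw')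
      (weightedTranslation Φ lam a w hw) := by
  intro f
  apply Subtype.ext
  apply AEEqFun.ext
  filter_upwards [weightedTranslation_apply_ae Φ lam a w hw
    (weightedTranslation Φ lam a⁻¹ (inverseWeight a w) hw' f), ae_mul_right a⁻¹
    (weightedTranslation_apply_ae Φ lam a⁻¹ (inverseWeight a w) hw' f)] with x h1 h2
  rw [h1, h2, inverseWeight, inv_inv, inv_mul_cancel_right, ← mul_assoc, ← Complex.ofReal_mul,
    mul_inv_cancel₀ (hw.pos x).ne', Complex.ofReal_one, one_mul]

end WeightedTranslation

/-! ### Recurrence versus smallness of the weight products. -/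

theorem YoungFunction.memOrlicz_indicator_one {α : Type*} [MeasurableSpace α] {Φ : YoungFunction}
    {μ : Measure α} {K : Set α} (hK : MeasurableSet K) (hμ : μ K ≠ ∞) :
    Φ.MemOrlicz μ (K.indicator fun _ => (1 : ℂ)) := by
  refine ⟨1, one_pos, ?_⟩
  have h := modular_div_le_of_bounded (Φ := Φ) (μ := μ) (f := K.indicator fun _ => (1 : ℂ)) hK
    (R := 1) one_pos (Eventually.of_forall fun x => by by_cases hx : x ∈ K <;> simp [hx])
    (Eventually.of_forall fun x hx => by simp [hx])
  simp only [div_one] at h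
  simp only [one_mul]
  exact h.trans_lt (ENNReal.mul_lt_top ENNReal.ofReal_lt_top hμ.lt_top)

/-- Recurrence of order `(L+1)(N+1)` yields arbitrarily large return times: replace `n` by `(N+1)
n`, whose first `L` multiples are among the controlled multiples of `n`. -/
theorem TopologicallyMultiplyRecurrent.exists_forall_le {X : Type*} [TopologicalSpace X]
    {T : X → X} (hT : TopologicallyMultiplyRecurrent T) (L : ℕ) {U : Set X} (hU : IsOpen U)
    (hne : U.Nonempty) (N : ℕ) :
    ∃ n : ℕ, N ≤ n ∧ 1 ≤ n ∧ ∃ x, ∀ l ≤ L, T^[l * n] x ∈ U := by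
  obtain ⟨n, hn, x, hx⟩ := hT ((L + 1) * (N + 1)) (Nat.mul_pos L.succ_pos N.succ_pos) U hU hne
  refine ⟨(N + 1) * n, by nlinarith, by nlinarith, x, fun l hl => ?_⟩
  rw [← mul_assoc]
  exact Set.mem_iInter₂.1 hx (l * (N + 1)) (Finset.mem_range.2 (by nlinarith))

section WeightedTranslation

variable {G : Type*} [Group G] [TopologicalSpace G] [IsTopologicalGroup G]
  [SecondCountableTopology G] [MeasurableSpace G] [BorelSpace G]
  {lam : Measure G} [lam.IsMulRightInvariant] {Φ : YoungFunction} {a : G} {w : G → ℝ}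

/-- A function whose iterates under `T_{a,w}` are close to the indicator of `K` forces the weight
products to be small on most of `K`, once `K` is disjoint from its translates. -/
theorem exists_measurableSet_weightProd_le [T2Space G] [IsFiniteMeasureOnCompacts lam]
    (hw : IsWeight w) {K : Set G} (hK : IsCompact K) {ε : ℝ} (hε : 0 < ε) (hε1 : ε < 1)
    {L n : ℕ} (hdisj : ∀ l, 1 ≤ l → ∀ x ∈ K, x * a ^ (l * n) ∉ K)
    (χ f : OrliczSpace Φ lam)
    (hχ : (χ : G →ₘ[lam] ℂ) =ᵐ[lam] K.indicator fun _ => 1)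
    (hf : ∀ l ≤ L, ‖(weightedTranslation Φ lam a w hw)^[l * n] f - χ‖ < ε ^ 2) :
    ∃ E : Set G, MeasurableSet E ∧ E ⊆ K ∧
      lam (K \ E) ≤ (L + 1 : ℕ) * (3 * (ENNReal.ofReal (Φ (1 / ε)))⁻¹) ∧
      ∀ l, 1 ≤ l → l ≤ L →
        (∀ᵐ x ∂lam, x ∈ E → weightProd a w (l * n) x ≤ ε / (1 - ε)) ∧
        (∀ᵐ x ∂lam, x ∈ E → weightProdInv a w (l * n) x ≤ ε / (1 - ε)) := by
  set T := weightedTranslation Φ lam a w hw with hT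
  let u : ℕ → G → ℂ := fun l => ((T^[l * n] f - χ : OrliczSpace Φ lam) : G →ₘ[lam] ℂ)
  have hum : ∀ l, Measurable (u l) := fun l => AEEqFun.measurable _
  let B : ℕ → Set G := fun l => {x | ε ≤ ‖u l x‖}
  have hB : ∀ l, MeasurableSet (B l) := fun l => measurableSet_le measurable_const (hum l).norm
  set δ := (ENNReal.ofReal (Φ (1 / ε)))⁻¹ with hδ
  have hBδ : ∀ l ≤ L, lam (B l) ≤ δ := fun l hl =>
    YoungFunction.measure_norm_ge_le hε (AEEqFun.aestronglyMeasurable _)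
      (T^[l * n] f - χ : OrliczSpace Φ lam).2 (hf l hl)
  -- Outside `D l`, the function `T^{ln} f` is within `ε` of the indicator at `x` and at `x a^{ln}`,
  -- and `f` is so at `x a^{-ln}`. The index `l = 0` covers `f` at `x`.
  let D : ℕ → Set G := fun l => B l ∪ (fun x => x * a ^ (l * n)) ⁻¹' B l ∪
    (fun x => x * (a ^ (l * n))⁻¹) ⁻¹' B 0
  have hD : ∀ l, MeasurableSet (D l) := fun l =>
    ((hB l).union (measurable_mul_const _ (hB l))).union (measurable_mul_const _ (hB 0))
  have hDδ : ∀ l ≤ L, lam (D l) ≤ 3 * δ := by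
    intro l hl
    calc lam (D l) ≤ lam (B l) + lam (B l) + lam (B 0) := by
          refine (measure_union_le _ _).trans (add_le_add ((measure_union_le _ _).trans ?_) ?_)
          · rw [measure_preimage_mul_right]
          · rw [measure_preimage_mul_right]
      _ ≤ δ + δ + δ := by gcongr <;> first | exact hBδ l hl | exact hBδ 0 (Nat.zero_le _)
      _ = 3 * δ := by ring
  have hval : ∀ l, ∀ᵐ x ∂lam, u l x = (T^[l * n] f : G →ₘ[lam] ℂ) x
      - K.indicator (fun _ => (1 : ℂ)) x := by
    intro l
    filter_upwards [OrliczSpace.coeFn_sub (T^[l * n] f) χ, hχ] with x h1 h2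
    rw [← h2]
    exact h1
  have hval0 : ∀ᵐ x ∂lam, u 0 x = (f : G →ₘ[lam] ℂ) x - K.indicator (fun _ => (1 : ℂ)) x := by
    simpa using hval 0
  have hone : ∀ z : ℂ, ‖z - 1‖ < ε → 1 - ε < ‖z‖ := by
    intro z hz
    have := norm_sub_norm_le 1 z
    rw [norm_sub_rev, norm_one] at this
    linarith
  refine ⟨K \ ⋃ l ∈ Finset.range (L + 1), D l,
    hK.measurableSet.diff (Finset.measurableSet_biUnion _ fun l _ => hD l), Set.sdiff_subset,
    ?_, fun l hl1 hlL => ?_⟩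
  · calc lam (K \ (K \ ⋃ l ∈ Finset.range (L + 1), D l))
        ≤ lam (⋃ l ∈ Finset.range (L + 1), D l) := by
          refine measure_mono ?_
          rw [Set.sdiff_sdiff_right_self]
          exact Set.inter_subset_right
      _ ≤ ∑ l ∈ Finset.range (L + 1), lam (D l) := measure_biUnion_finset_le _ _
      _ ≤ ∑ l ∈ Finset.range (L + 1), 3 * δ := Finset.sum_le_sum fun l hl =>
          hDδ l (Nat.lt_succ_iff.1 (Finset.mem_range.1 hl))
      _ = _ := by simp
  · have hgood : ∀ x ∈ K \ ⋃ l ∈ Finset.range (L + 1), D l, ∀ l ≤ L, ‖u l x‖ < ε ∧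
        ‖u l (x * a ^ (l * n))‖ < ε ∧ ‖u 0 (x * (a ^ (l * n))⁻¹)‖ < ε := by
      intro x hx l hl
      have hxD : x ∉ D l := fun h =>
        hx.2 (Set.mem_biUnion (Finset.mem_coe.2 (Finset.mem_range.2 (by omega))) h)
      simpa [D, B, not_or, and_assoc] using hxD
    constructor
    -- Here `|f(x)| > 1 - ε`, while `φ_{ln}(x) |f(x)| < ε` because `x a^{ln} ∉ K`.
    · filter_upwards [hval0, ae_mul_right (a ^ (l * n)) (hval l),
        weightedTranslation_iterate_apply_mul_pow_ae (a := a) hw (l * n) f] with x h1 h2 h3 hx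
      have g1 := (hgood x hx 0 (Nat.zero_le _)).1
      have g2 := (hgood x hx l hlL).2.1
      rw [h1, Set.indicator_of_mem hx.1] at g1
      rw [h2, Set.indicator_of_notMem (hdisj l hl1 x hx.1), sub_zero, h3, norm_mul,
        Complex.norm_real, Real.norm_of_nonneg (weightProd_pos a hw.pos _ _).le] at g2
      rw [le_div_iff₀ (by linarith)]
      nlinarith [hone _ g1, weightProd_pos a hw.pos (l * n) x]
    -- Here `|f(x a^{-ln})| < ε`, while its product with `1 / φ̃_{ln}(x)` exceeds `1 - ε`.
    · filter_upwards [hval l, ae_mul_right (a ^ (l * n))⁻¹ hval0,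
        weightedTranslation_iterate_apply_ae (a := a) hw (l * n) f] with x h1 h2 h3 hx
      have g1 := (hgood x hx l hlL).1
      have g2 := (hgood x hx l hlL).2.2
      have hxK : x * (a ^ (l * n))⁻¹ ∉ K := fun h =>
        hdisj l hl1 _ h (by simpa using hx.1)
      rw [h1, Set.indicator_of_mem hx.1] at g1
      rw [h2, Set.indicator_of_notMem hxK, sub_zero] at g2
      have g3 := hone _ g1
      have hpos : 0 < ∏ j ∈ Finset.range (l * n), w (x * (a ^ j)⁻¹) :=
        Finset.prod_pos fun _ _ => hw.pos _
      rw [h3, norm_mul, Complex.norm_real, Real.norm_of_nonneg hpos.le] at g3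
      rw [weightProdInv, inv_le_comm₀ (by simpa [convDirac] using hpos)
        (div_pos hε (by linarith)), inv_div, div_le_iff₀ hε]
      simp only [convDirac]
      nlinarith

/-- If the weight products are small on the support of `g`, then some vector close to `g` has
its iterates of orders `n, 2n, …, Ln` close to `g` as well. -/
theorem exists_forall_norm_iterate_sub_le (hw : IsWeight w)
    (hw_inv : BddAbove (Set.range fun x => (w x)⁻¹)) {L n : ℕ} {c : ℝ} (hc : 0 < c)
    (g : OrliczSpace Φ lam)
    (h : ∀ l, 1 ≤ l → l ≤ L → ∀ᵐ x ∂lam, (g : G →ₘ[lam] ℂ) x ≠ 0 →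
      weightProd a w (l * n) x ≤ c ∧ weightProdInv a w (l * n) x ≤ c) :
    ∃ v : OrliczSpace Φ lam, ∀ l ≤ L,
      ‖(weightedTranslation Φ lam a w hw)^[l * n] v - g‖ ≤ L * (c * ‖g‖) := by
  set T := weightedTranslation Φ lam a w hw with hT
  have hw' := hw.inverseWeight hw_inv a
  set S := weightedTranslation Φ lam a⁻¹ (inverseWeight a w) hw' with hS
  have hTS : ∀ k, Function.RightInverse S^[k] T^[k] := fun k =>
    (weightedTranslation_rightInverse hw hw').iterate k
  have hTn : ∀ l, 1 ≤ l → l ≤ L → ‖T^[l * n] g‖ ≤ c * ‖g‖ := fun l h1 hL =>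
    norm_weightedTranslation_iterate_le hw _ g hc ((h l h1 hL).mono fun x hx h0 => (hx h0).1)
  have hSn : ∀ l, 1 ≤ l → l ≤ L → ‖S^[l * n] g‖ ≤ c * ‖g‖ := fun l h1 hL =>
    norm_weightedTranslation_iterate_le hw' _ g hc ((h l h1 hL).mono fun x hx h0 => by
      rw [weightProd_inv_inverseWeight]; exact (hx h0).2)
  -- Applying `T^{ln}` leaves `T^{(l-m)n} g` for `m < l`, `g` for `m = l`, and `S^{(m-l)n} g` for `m
  -- > l`.
  refine ⟨∑ m ∈ Finset.range (L + 1), S^[m * n] g, fun l hl => ?_⟩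
  have hterm : ∀ m ∈ (Finset.range (L + 1)).erase l, ‖T^[l * n] (S^[m * n] g)‖ ≤ c * ‖g‖ := by
    intro m hm
    rw [Finset.mem_erase, Finset.mem_range] at hm
    rcases lt_or_gt_of_ne hm.1 with hlt | hlt
    · have e : l * n = (l - m) * n + m * n := by rw [← add_mul, Nat.sub_add_cancel hlt.le]
      rw [e, Function.iterate_add_apply, hTS]
      exact hTn _ (by omega) (by omega)
    · have e : m * n = l * n + (m - l) * n := by rw [← add_mul, Nat.add_sub_cancel' hlt.le]
      rw [e, Function.iterate_add_apply, hTS]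
      exact hSn _ (by omega) (by omega)
  have hmem : l ∈ Finset.range (L + 1) := Finset.mem_range.2 (by omega)
  have hsum : T^[l * n] (∑ m ∈ Finset.range (L + 1), S^[m * n] g) - g
      = ∑ m ∈ (Finset.range (L + 1)).erase l, T^[l * n] (S^[m * n] g) := by
    rw [← FunLike.coe_pow_eq_iterate, map_sum, ← Finset.add_sum_erase _ _ hmem,
      FunLike.coe_pow_eq_iterate, hTS, add_sub_cancel_left]
  rw [hsum]
  refine (norm_sum_le_of_le _ hterm).trans ?_
  simp [Finset.card_erase_of_mem hmem]

end WeightedTranslation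

/-! ### The two implications. -/

section MultipleRecurrence

variable {G : Type*} [Group G] [TopologicalSpace G] [IsTopologicalGroup G]
  [LocallyCompactSpace G] [T2Space G] [SecondCountableTopology G]
  [MeasurableSpace G] [BorelSpace G] {lam : Measure G} [lam.IsMulRightInvariant]
  [IsFiniteMeasureOnCompacts lam] {Φ : YoungFunction} {a : G} {w : G → ℝ}

/-- Recurrence forces the weight products to decay along a sequence on large subsets of `K`. -/
theorem exists_seq_of_topologicallyMultiplyRecurrent (ha : IsAperiodic a) (hw : IsWeight w)
    (hT : TopologicallyMultiplyRecurrent (weightedTranslation Φ lam a w hw)) (L : ℕ) {K : Set G}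
    (hK : IsCompact K) :
    ∃ (E : ℕ → Set G) (n : ℕ → ℕ),
      (∀ k, MeasurableSet (E k) ∧ E k ⊆ K) ∧
      Tendsto (fun k => lam (E k)) atTop (𝓝 (lam K)) ∧
      StrictMono n ∧ (∀ k, 1 ≤ n k) ∧
      ∀ l : ℕ, 1 ≤ l → l ≤ L →
        Tendsto (fun k => eLpNorm (weightProd a w (l * n k)) ∞ (lam.restrict (E k)))
          atTop (𝓝 0) ∧
        Tendsto (fun k => eLpNorm (weightProdInv a w (l * n k)) ∞ (lam.restrict (E k)))
          atTop (𝓝 0) := by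
  have hKfin : lam K ≠ ∞ := hK.measure_lt_top.ne
  let χ : OrliczSpace Φ lam := OrliczSpace.mk (K.indicator fun _ => 1)
    (aestronglyMeasurable_const.indicator hK.measurableSet)
    (YoungFunction.memOrlicz_indicator_one hK.measurableSet hKfin)
  -- The shift by 2 keeps `ε k < 1` at `k = 0` and makes `ε k / (1 - ε k) = 1 / (k + 1)`.
  let ε : ℕ → ℝ := fun k => 1 / ((k : ℝ) + 2)
  have hε : ∀ k, 0 < ε k := fun k => by positivity
  have hε1 : ∀ k, ε k < 1 := fun k => by
    rw [div_lt_one (by positivity)]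
    linarith [(k.cast_nonneg : (0 : ℝ) ≤ k)]
  obtain ⟨N₀, hN₀⟩ := eventually_atTop.1 (ha.eventually_mul_pow_notMem hK)
  -- Having, for each `k`, arbitrarily large admissible `n` allows a strictly increasing choice of
  -- `n k`.
  have hfreq : ∀ k : ℕ, ∃ᶠ n : ℕ in atTop, 1 ≤ n ∧
      ∃ E : Set G, MeasurableSet E ∧ E ⊆ K ∧
      lam (K \ E) ≤ (L + 1 : ℕ) * (3 * (ENNReal.ofReal (Φ (1 / ε k)))⁻¹) ∧
      ∀ l, 1 ≤ l → l ≤ L →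
        (∀ᵐ x ∂lam, x ∈ E → weightProd a w (l * n) x ≤ ε k / (1 - ε k)) ∧
        (∀ᵐ x ∂lam, x ∈ E → weightProdInv a w (l * n) x ≤ ε k / (1 - ε k)) := by
    refine fun k => frequently_atTop.2 fun N => ?_
    obtain ⟨n, hn, hn1, f, hf⟩ := hT.exists_forall_le L (Metric.isOpen_ball (x := χ))
      ⟨χ, Metric.mem_ball_self (pow_pos (hε k) 2)⟩ (N + N₀)
    refine ⟨n, by omega, hn1, exists_measurableSet_weightProd_le hw hK (hε k) (hε1 k)
      (fun l hl x hx => hN₀ _ (by nlinarith) x hx) χ f (OrliczSpace.coeFn_mk _ _ _)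
      fun l hl => ?_⟩
    rw [← dist_eq_norm]
    exact hf l hl
  obtain ⟨n, hn, hP⟩ := extraction_forall_of_frequently hfreq
  choose hn1 E hEm hEK hEδ hEw using hP
  refine ⟨E, n, fun k => ⟨hEm k, hEK k⟩, ?_, hn, hn1, fun l hl hlL => ?_⟩
  · have hlim : Tendsto (fun k => (L + 1 : ℕ) * (3 * (ENNReal.ofReal (Φ (1 / ε k)))⁻¹)) atTop
        (𝓝 0) := by
      have h := Φ.tendsto_inv_ofReal_apply_inv (u := fun k : ℕ => 1 / ε k) (by
        simp only [ε, one_div_one_div]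
        exact tendsto_atTop_add_const_right _ _ tendsto_natCast_atTop_atTop)
      simpa using ENNReal.Tendsto.const_mul
        (ENNReal.Tendsto.const_mul h (Or.inr (by simp : (3 : ℝ≥0∞) ≠ ∞)))
        (Or.inr (ENNReal.natCast_ne_top (L + 1)))
    have hsub := ENNReal.Tendsto.sub (tendsto_const_nhds (x := lam K)) hlim (Or.inl hKfin)
    rw [tsub_zero] at hsub
    refine tendsto_of_tendsto_of_tendsto_of_le_of_le hsub tendsto_const_nhds (fun k => ?_)
      fun k => measure_mono (hEK k)
    rw [tsub_le_iff_right]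
    calc lam K ≤ lam (E k ∪ K \ E k) := measure_mono (by simp)
      _ ≤ lam (E k) + lam (K \ E k) := measure_union_le _ _
      _ ≤ _ := add_le_add_right (hEδ k) _
  · have hlim : Tendsto (fun k => ENNReal.ofReal (ε k / (1 - ε k))) atTop (𝓝 0) := by
      rw [← ENNReal.ofReal_zero]
      refine ENNReal.tendsto_ofReal (tendsto_one_div_add_atTop_nhds_zero_nat.congr fun k => ?_)
      simp only [ε]
      have h1 : (k : ℝ) + 1 ≠ 0 := by positivity
      have h2 : (k : ℝ) + 2 ≠ 0 := by positivity
      have h3 : 1 - 1 / ((k : ℝ) + 2) = ((k : ℝ) + 1) / (k + 2) := by field_simp; ring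
      rw [h3]
      field_simp
    have hbound : ∀ (u : ℕ → G → ℝ), (∀ k x, 0 < u k x) →
        (∀ k, ∀ᵐ x ∂lam, x ∈ E k → u k x ≤ ε k / (1 - ε k)) →
        Tendsto (fun k => eLpNorm (u k) ∞ (lam.restrict (E k))) atTop (𝓝 0) := by
      intro u hu0 hu
      refine tendsto_of_tendsto_of_tendsto_of_le_of_le tendsto_const_nhds hlim
        (fun _ => zero_le) fun k => ?_
      rw [eLpNorm_exponent_top]
      refine eLpNormEssSup_le_of_ae_bound ((ae_restrict_iff' (hEm k)).2 ?_)
      filter_upwards [hu k] with x hx hxE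
      rw [Real.norm_of_nonneg (hu0 k x).le]
      exact hx hxE
    exact ⟨hbound _ (fun k x => weightProd_pos a hw.pos _ x) fun k => (hEw k l hl hlL).1,
      hbound _ (fun k x => weightProdInv_pos a hw.pos _ x) fun k => (hEw k l hl hlL).2⟩

theorem ae_le_of_eLpNorm_top_lt {α : Type*} [MeasurableSpace α] {μ : Measure α} {E : Set α}
    (hE : MeasurableSet E) {u : α → ℝ} {c : ℝ} (hc : 0 ≤ c)
    (h : eLpNorm u ∞ (μ.restrict E) < ENNReal.ofReal c) : ∀ᵐ x ∂μ, x ∈ E → u x ≤ c := by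
  rw [eLpNorm_exponent_top] at h
  filter_upwards [(ae_restrict_iff' hE).1 (ae_le_eLpNormEssSup (f := u))] with x hx hxE
  have h1 := (hx hxE).trans h.le
  rw [← ofReal_norm, ENNReal.ofReal_le_ofReal_iff hc] at h1
  exact (Real.le_norm_self _).trans h1

/-- Decay of the weight products on large subsets of compact sets implies recurrence. -/
theorem topologicallyMultiplyRecurrent_of_exists_seq [lam.IsOpenPosMeasure] {M : ℝ} (hM : 0 < M)
    (hΦ : ∀ t > 0, Φ (2 * t) ≤ M * Φ t) (hw : IsWeight w)
    (hw_inv : BddAbove (Set.range fun x => (w x)⁻¹))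
    (h : ∀ L : ℕ, 1 ≤ L → ∀ K : Set G, IsCompact K → 0 < lam K →
        ∃ (E : ℕ → Set G) (n : ℕ → ℕ),
          (∀ k, MeasurableSet (E k) ∧ E k ⊆ K) ∧
          Tendsto (fun k => lam (E k)) atTop (𝓝 (lam K)) ∧
          StrictMono n ∧ (∀ k, 1 ≤ n k) ∧
          ∀ l : ℕ, 1 ≤ l → l ≤ L →
            Tendsto (fun k => eLpNorm (weightProd a w (l * n k)) ∞ (lam.restrict (E k)))
              atTop (𝓝 0) ∧
            Tendsto (fun k => eLpNorm (weightProdInv a w (l * n k)) ∞ (lam.restrict (E k)))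
              atTop (𝓝 0)) :
    TopologicallyMultiplyRecurrent (weightedTranslation Φ lam a w hw) := by
  rintro L hL U hU ⟨f, hfU⟩
  obtain ⟨r, hr, hrU⟩ := Metric.isOpen_iff.1 hU f hfU
  -- The three errors `f - g`, `g - g'` and `T^{ln} v - g'` get `r / 4` each, so the total stays
  -- below `r`.
  obtain ⟨g, K₀, R, hK₀, hfg, hgR, hg0⟩ :=
    OrliczSpace.exists_bounded_compactSupport_norm_sub_le hM hΦ f (ε := r / 4) (by positivity)
  obtain ⟨V, hV, hV1⟩ := exists_compact_mem_nhds (1 : G)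
  -- Adjoining a compact neighbourhood of 1 ensures positive measure even if `K₀` is null.
  set K := K₀ ∪ V with hKdef
  have hK : IsCompact K := hK₀.union hV
  have hKpos : 0 < lam K := (Measure.measure_pos_of_mem_nhds lam hV1).trans_le
    (measure_mono Set.subset_union_right)
  obtain ⟨E, n, hE, hElim, -, hn1, hElw⟩ := h L hL K hK hKpos
  have hdiff : Tendsto (fun k => lam (K \ E k)) atTop (𝓝 0) := by
    have h1 := ENNReal.Tendsto.sub (tendsto_const_nhds (x := lam K)) hElim
      (Or.inl hK.measure_lt_top.ne)
    rw [tsub_self] at h1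
    refine h1.congr fun k => ?_
    rw [measure_sdiff (hE k).2 (hE k).1.nullMeasurableSet
      ((measure_mono (hE k).2).trans_lt hK.measure_lt_top).ne]
  -- The quantity on the left bounds the modular at scale `r / 4` of the part of `g` cut off outside
  -- `E k`.
  have hmod : ∀ᶠ k in atTop, ENNReal.ofReal (Φ (R / (r / 4))) * lam (K \ E k) ≤ 1 := by
    have h1 := ENNReal.Tendsto.const_mul hdiff
      (Or.inr (ENNReal.ofReal_ne_top (r := Φ (R / (r / 4)))))
    rw [mul_zero] at h1
    exact h1.eventually_le_const zero_lt_one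
  have hLpos : (0 : ℝ) < L := by exact_mod_cast hL
  -- Chosen so that `L c (‖g‖ + 1) = r / 4`; the summand 1 covers `g = 0`.
  set c := r / (4 * (L * (‖g‖ + 1))) with hc
  have hcpos : 0 < c := by positivity
  have hsmall : ∀ᶠ k in atTop, ∀ l ∈ Finset.Icc 1 L,
      eLpNorm (weightProd a w (l * n k)) ∞ (lam.restrict (E k)) < ENNReal.ofReal c ∧
      eLpNorm (weightProdInv a w (l * n k)) ∞ (lam.restrict (E k)) < ENNReal.ofReal c := by
    refine (Finset.eventually_all _).2 fun l hl => ?_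
    rw [Finset.mem_Icc] at hl
    have hc' : 0 < ENNReal.ofReal c := ENNReal.ofReal_pos.2 hcpos
    exact ((hElw l hl.1 hl.2).1.eventually_lt_const hc').and
      ((hElw l hl.1 hl.2).2.eventually_lt_const hc')
  obtain ⟨k, hk1, hk2⟩ := (hmod.and hsmall).exists
  have hEm := (hE k).1
  set g' := OrliczSpace.truncate g hEm with hg'
  have hgg' : ‖g - g'‖ ≤ r / 4 := by
    refine OrliczSpace.norm_le_of_modular_le_one _ (by positivity)
      (OrliczSpace.coeFn_sub_truncate g hEm) (le_trans ?_ hk1)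
    refine YoungFunction.modular_div_le_of_bounded (hK.measurableSet.diff hEm) (by positivity)
      (hgR.mono fun x hx => (norm_indicator_le_norm_self _ _).trans hx)
      (hg0.mono fun x hx hxA => ?_)
    by_cases hxE : x ∈ E k
    · simp [hxE]
    · rw [Set.indicator_of_mem hxE]
      exact hx fun hxK => hxA ⟨Or.inl hxK, hxE⟩
  obtain ⟨v, hv⟩ := exists_forall_norm_iterate_sub_le (n := n k) hw hw_inv hcpos g'
    (fun l hl hlL => by
      obtain ⟨b1, b2⟩ := hk2 l (Finset.mem_Icc.2 ⟨hl, hlL⟩)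
      filter_upwards [OrliczSpace.coeFn_truncate g hEm, ae_le_of_eLpNorm_top_lt hEm hcpos.le b1,
        ae_le_of_eLpNorm_top_lt hEm hcpos.le b2] with x hx h1 h2 h0
      have hxE : x ∈ E k := by
        by_contra hxE
        exact h0 (by rw [hx, Set.indicator_of_notMem hxE])
      exact ⟨h1 hxE, h2 hxE⟩)
  have hsmall' : L * (c * ‖g'‖) ≤ r / 4 := by
    have hle : ‖g'‖ ≤ ‖g‖ + 1 := (OrliczSpace.norm_truncate_le g hEm).trans (by linarith)
    calc L * (c * ‖g'‖) ≤ L * (c * (‖g‖ + 1)) := by gcongr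
      _ = r / 4 := by
        have : ‖g‖ + 1 ≠ 0 := by positivity
        rw [hc]; field_simp
  refine ⟨n k, hn1 k, v, Set.mem_iInter₂.2 fun l hl => hrU ?_⟩
  rw [Metric.mem_ball, dist_eq_norm]
  set y := (weightedTranslation Φ lam a w hw)^[l * n k] v with hy
  have hyg : ‖y - g'‖ ≤ r / 4 :=
    (hv l (Nat.lt_succ_iff.1 (Finset.mem_range.1 hl))).trans hsmall'
  calc ‖y - f‖ = ‖(y - g') - (g - g') - (f - g)‖ := by congr 1; abel
    _ ≤ ‖y - g'‖ + ‖g - g'‖ + ‖f - g‖ :=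
      (norm_sub_le _ _).trans (by gcongr; exact norm_sub_le _ _)
    _ < r := by linarith

end MultipleRecurrence

theorem theorem2p2 {G : Type*} [Group G] [TopologicalSpace G] [IsTopologicalGroup G]
    [LocallyCompactSpace G] [T2Space G] [SecondCountableTopology G]
    [MeasurableSpace G] [BorelSpace G]
    (lam : Measure G) [lam.IsMulRightInvariant] [IsFiniteMeasureOnCompacts lam]
    [lam.IsOpenPosMeasure]
    (Φ : YoungFunction) (hΦ : Φ.IsDelta2Regular G)
    (a : G) (ha : IsAperiodic a)
    (w : G → ℝ) (hw : IsWeight w) (hw_inv : BddAbove (Set.range fun x => (w x)⁻¹)) :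
    TopologicallyMultiplyRecurrent (weightedTranslation Φ lam a w hw) ↔
      ∀ L : ℕ, 1 ≤ L → ∀ K : Set G, IsCompact K → 0 < lam K →
        ∃ (E : ℕ → Set G) (n : ℕ → ℕ),
          (∀ k, MeasurableSet (E k) ∧ E k ⊆ K) ∧
          Tendsto (fun k => lam (E k)) atTop (𝓝 (lam K)) ∧
          StrictMono n ∧ (∀ k, 1 ≤ n k) ∧
          ∀ l : ℕ, 1 ≤ l → l ≤ L →
            Tendsto (fun k => eLpNorm (weightProd a w (l * n k)) ∞ (lam.restrict (E k)))
              atTop (𝓝 0) ∧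
            Tendsto (fun k => eLpNorm (weightProdInv a w (l * n k)) ∞ (lam.restrict (E k)))
              atTop (𝓝 0) := by
  obtain ⟨M, hM, hΦM⟩ := hΦ.2 ha.not_compactSpace
  exact ⟨fun hT L _ K hK _ => exists_seq_of_topologicallyMultiplyRecurrent ha hw hT L hK,
    topologicallyMultiplyRecurrent_of_exists_seq hM hΦM hw hw_inv⟩
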